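/- Let $n\ge 0$, and let $\mathbb{R}^{n+2}_1$ be $\mathbb{R}^{n+2}$ with the Lorentzian metric $\langle x,y\rangle=-x_0y_0+x_1y_1+\dots+x_{n+1}y_{n+1}$. Let $e_0=(1,0,\dots,0)$ and let $a\in\mathbb{R}^{n+2}_1$ be a past-pointing null vector, that is, $\langle a,a\rangle=0$ and $\langle a,e_0\rangle>0$. The steady state space is $\mathcal{H}^{n+1}=\{x\in\mathbb{R}^{n+2}_1:\langle x,x\rangle=1,\ \langle x,a\rangle>0\}$ with the induced Lorentzian metric, and $L_1=\{x\in\mathcal{H}^{n+1}:\langle x,a\rangle=1\}$. A spacelike hypersurface is a smooth immersion $\psi:\Sigma^n\to\mathcal{H}^{n+1}$ of a connected $n$-dimensional manifold (without boundary) that induces a Riemannian metric on $\Sigma$; it is complete if this metric is complete, and bounded away from the future infinity if there is $\overline{\tau}>0$ with $\langle\psi(p),a\rangle\le\overline{\tau}$ for all $p\in\Sigma$. Let $\psi:\Sigma^n\to\mathcal{H}^{n+1}$ be a complete spacelike hypersurface that is bounded away from the future infinity. Then $\Sigma$ is diffeomorphic to $\mathbb{R}^n$. Moreover, for every $p\in\Sigma$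 there is exactly one point $\Pi(p)\in L_1$ such that $\psi(p)$ lies on the future-pointing unit timelike geodesic of $\mathcal{H}^{n+1}$ that meets $L_1$ orthogonally at $\Pi(p)$, and the map $\Pi:\Sigma\to L_1$ (the orthogonal geodesic projection) is a diffeomorphism. In particular, if $n\ge 1$, there is no compact spacelike hypersurface (without boundary) in $\mathcal{H}^{n+1}$. -/

import Mathlib

open scoped Manifold ContDiff

noncomputable section

namespace SteadyState

/-- The underlying real vector space `ℝⁿ⁺²` of the Lorentz–Minkowski space. Its Euclidean norm is
used only for the smooth structure. -/
abbrev Mink (n : ℕ) : Type := EuclideanSpace ℝ (Fin (n + 2))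

/-- The Lorentzian metric `-(dx₀)² + (dx₁)² + ⋯ + (dxₙ₊₁)²`. -/
def lorentz {n : ℕ} (x y : Mink n) : ℝ :=
  -(x 0 * y 0) + ∑ i : Fin (n + 1), x i.succ * y i.succ

/-- The vector `e₀ = (1, 0, …, 0)`. -/
def e₀ (n : ℕ) : Mink n := EuclideanSpace.single 0 1

/-- `a` is a (necessarily non-zero) past-pointing null vector. -/
def IsPastNull {n : ℕ} (a : Mink n) : Prop :=
  lorentz a a = 0 ∧ 0 < lorentz a (e₀ n)

/-- The de Sitter space `𝕊₁ⁿ⁺¹`. -/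
def deSitter (n : ℕ) : Set (Mink n) := {x | lorentz x x = 1}

/-- The steady state space `ℋⁿ⁺¹` determined by `a`. -/
def space {n : ℕ} (a : Mink n) : Set (Mink n) := {x | x ∈ deSitter n ∧ 0 < lorentz x a}

/-- The leaf `L_τ` of `ℋⁿ⁺¹`. -/
def leaf {n : ℕ} (a : Mink n) (τ : ℝ) : Set (Mink n) := {x | x ∈ space a ∧ lorentz x a = τ}

/-- The tangent space at `q` of the leaf of `ℋⁿ⁺¹` through `q`. -/
def leafTangent {n : ℕ} (a q : Mink n) : Set (Mink n) := {v | lorentz v q = 0 ∧ lorentz v a = 0}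

/-- `γ : ℝ → ℋⁿ⁺¹` is a geodesic: its acceleration is everywhere normal to the de Sitter space,
whose normal line at `x` is `ℝ x`. -/
structure IsGeodesic {n : ℕ} (a : Mink n) (γ : ℝ → Mink n) : Prop where
  smooth : ContDiff ℝ ∞ γ
  mem : ∀ t, γ t ∈ space a
  normal : ∀ t, ∃ c : ℝ, deriv (deriv γ) t = c • γ t

/-- `γ` is a future-pointing unit timelike geodesic of `ℋⁿ⁺¹` which starts at `q` orthogonally to
the leaf through `q`. -/
structure IsOrthogonalGeodesic {n : ℕ} (a q : Mink n) (γ : ℝ → Mink n) : Prop where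
  geodesic : IsGeodesic a γ
  start : γ 0 = q
  unit : lorentz (deriv γ 0) (deriv γ 0) = -1
  future : lorentz (deriv γ 0) (e₀ n) < 0
  orthogonal : ∀ v ∈ leafTangent a q, lorentz (deriv γ 0) v = 0

/-- `q` is an orthogonal geodesic projection of `x` onto `L₁`: the point `q` lies in `L₁`, and `x`
lies on a geodesic which is orthogonal to `L₁` at `q`. -/
def IsGeodesicProjection {n : ℕ} (a x q : Mink n) : Prop :=
  q ∈ leaf a 1 ∧ ∃ γ : ℝ → Mink n, IsOrthogonalGeodesic a q γ ∧ ∃ t : ℝ, γ t = x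

section Hypersurface

variable {n : ℕ} {S : Type*} [TopologicalSpace S] [ChartedSpace (EuclideanSpace ℝ (Fin n)) S]

/-- The differential of `ψ : S → ℝⁿ⁺²` at `p`, with values in `ℝⁿ⁺²`. -/
def differential (ψ : S → Mink n) (p : S) : TangentSpace (𝓡 n) p →L[ℝ] Mink n :=
  mfderiv (𝓡 n) 𝓘(ℝ, Mink n) ψ p

/-- The bilinear form on `T_p S` induced by `ψ` from the Lorentzian metric. -/
def inducedForm (ψ : S → Mink n) (p : S) (v w : TangentSpace (𝓡 n) p) : ℝ :=
  lorentz (differential ψ p v) (differential ψ p w)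

/-- `ψ : S → ℋⁿ⁺¹` is a smooth map that induces a Riemannian metric on `S`. It is then an
immersion, since the differential of such a map has no kernel. -/
structure IsSpacelike (a : Mink n) (ψ : S → Mink n) : Prop where
  smooth : ContMDiff (𝓡 n) 𝓘(ℝ, Mink n) ∞ ψ
  mem : ∀ p, ψ p ∈ space a
  pos : ∀ (p : S) (v : TangentSpace (𝓡 n) p), v ≠ 0 → 0 < inducedForm ψ p v v

/-- The length `√⟨v, v⟩` of tangent vectors of `S` in the metric induced by `ψ`. -/
@[reducible]
def inducedENorm (ψ : S → Mink n) (p : S) : ENorm (TangentSpace (𝓡 n) p) :=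
  ⟨fun v => ENNReal.ofReal (Real.sqrt (inducedForm ψ p v v))⟩

/-- The Riemannian distance of the metric induced by `ψ`: the infimum of the lengths of the
`C¹` paths between two points. -/
def inducedEDist (ψ : S → Mink n) (p q : S) : ENNReal :=
  letI : ∀ x : S, ENorm (TangentSpace (𝓡 n) x) := inducedENorm ψ
  Manifold.riemannianEDist (𝓡 n) p q

/-- The metric induced by `ψ` is complete: every sequence that is Cauchy for its Riemannian
distance converges in `S`. -/
def IsCompleteHypersurface (ψ : S → Mink n) : Prop :=
  ∀ u : ℕ → S,
    (∀ ε : ENNReal, 0 < ε → ∃ N : ℕ, ∀ k ≥ N, ∀ l ≥ N, inducedEDist ψ (u k) (u l) < ε) →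
    ∃ p : S, Filter.Tendsto u Filter.atTop (nhds p)

/-- The hypersurface is bounded away from the future infinity of `ℋⁿ⁺¹`. -/
def IsBoundedAwayFromFuture (a : Mink n) (ψ : S → Mink n) : Prop :=
  ∃ τ : ℝ, 0 < τ ∧ ∀ p, lorentz (ψ p) a ≤ τ

/-- `f : S → ℝⁿ⁺²` is a diffeomorphism of `S` onto the embedded submanifold `A` of `ℝⁿ⁺²`: it is
smooth with image `A`, and has a smooth inverse `A → S`. Smoothness of a map on `A` means, as
usual, that it is the restriction of a smooth map on an open neighbourhood of `A`. -/
structure IsDiffeomorphismOnto (f : S → Mink n) (A : Set (Mink n)) : Prop where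
  smooth : ContMDiff (𝓡 n) 𝓘(ℝ, Mink n) ∞ f
  range_eq : Set.range f = A
  smooth_inverse : ∃ (U : Set (Mink n)) (g : Mink n → S), IsOpen U ∧ A ⊆ U ∧
    ContMDiffOn 𝓘(ℝ, Mink n) (𝓡 n) ∞ g U ∧ ∀ p, g (f p) = p

end Hypersurface

end SteadyState

end

/-! Write `τ = ⟨x, a⟩` and choose a null vector `b` with `⟨a, b⟩ = 1`. With `w` the Euclidean part
of `x` divided by `τ` (`NullFrame.coord`), the metric of the steady state space is `τ² |dw|² - τ⁻²
dτ²`. For a vector `v` tangent to the hypersurface this gives `⟨v, v⟩ ≤ τ² |dw(v)|²`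
(`NullFrame.norm_sq_coordDeriv`, `IsSpacelike.inducedForm_le`). Hence `w` restricts to a local
diffeomorphism to flat `ℝⁿ`, and a bound on `τ` means that it shrinks lengths by at most a constant
factor. If the hypersurface is complete, segments of `ℝⁿ` therefore lift, and the local
diffeomorphism is a bijection (`bijective_of_expanding`). The unit geodesics orthogonal to `L₁`
solve `γ'' = γ`, so they are explicit, and `w` is constant along them. The geodesic projection is
thus `w` followed by the parametrization of `L₁` (`isGeodesicProjection_iff`,
`NullFrame.param_coord`). In the compact case the image of `w` is open and closed in `ℝⁿ`, which
would make `ℝⁿ` compact. -/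

namespace SteadyState

/-! ### Path lifting along local homeomorphisms. -/

section PathLifting

open Set Filter Topology

variable {X Y : Type*} [TopologicalSpace X]

/-- `c` is a continuous lift of `γ` along `f` over the set `s` that starts at `x`. -/
structure IsLiftOn (f : X → Y) (γ : ℝ → Y) (x : X) (s : Set ℝ) (c : ℝ → X) : Prop where
  continuousOn : ContinuousOn c s
  zero : c 0 = x
  lifts : ∀ t ∈ s, f (c t) = γ t

theorem IsLiftOn.mono {f : X → Y} {γ : ℝ → Y} {x : X} {s s' : Set ℝ} {c : ℝ → X}
    (h : IsLiftOn f γ x s c) (hs : s' ⊆ s) : IsLiftOn f γ x s' c :=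
  ⟨h.continuousOn.mono hs, h.zero, fun t ht => h.lifts t (hs ht)⟩

variable [TopologicalSpace Y] [T2Space X]

theorem IsLiftOn.eqOn {f : X → Y} (hf : IsLocalHomeomorph f) {γ : ℝ → Y} {x : X} {T : ℝ}
    {c c' : ℝ → X} (h : IsLiftOn f γ x (Icc 0 T) c) (h' : IsLiftOn f γ x (Icc 0 T) c') :
    EqOn c c' (Icc 0 T) := by
  intro t ht
  have hT : (0 : ℝ) ≤ T := ht.1.trans ht.2
  have : PreconnectedSpace (Icc 0 T) := Subtype.preconnectedSpace isPreconnected_Icc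
  have key := (T2Space.isSeparatedMap f).eq_of_comp_eq hf.isLocallyInjective
    (continuousOn_iff_continuous_domRestrict.1 h.continuousOn)
    (continuousOn_iff_continuous_domRestrict.1 h'.continuousOn)
    (by ext s; simp [h.lifts s s.2, h'.lifts s s.2])
    ⟨0, left_mem_Icc.2 hT⟩ (by simp [h.zero, h'.zero])
  exact congrFun key ⟨t, ht⟩

/-- A path lifts along a local homeomorphism as soon as each lift over a half-open interval
accumulates at the end of the interval. -/
theorem exists_isLiftOn_Icc [T2Space Y] {f : X → Y} (hf : IsLocalHomeomorph f) {γ : ℝ → Y}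
    (hγ : Continuous γ) {x : X} (hx : f x = γ 0)
    (H : ∀ T ∈ Ioc (0 : ℝ) 1, ∀ c, IsLiftOn f γ x (Ico 0 T) c →
      ∃ z : X, MapClusterPt z (𝓝[<] T) c) :
    ∃ c, IsLiftOn f γ x (Icc 0 1) c := by
  -- Continuity method: a lift will be built up to some `T'` beyond the supremum of `A`, which is
  -- possible only if `T' ≥ 1`.
  set A : Set ℝ := {T | T ∈ Icc (0 : ℝ) 1 ∧ ∃ c, IsLiftOn f γ x (Icc 0 T) c} with hA
  have h0 : (0 : ℝ) ∈ A := by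
    refine ⟨by simp, fun _ => x, continuousOn_const, rfl, fun t ht => ?_⟩
    have : t = 0 := le_antisymm ht.2 ht.1
    rw [this, hx]
  have hbdd : BddAbove A := ⟨1, fun t ht => ht.1.2⟩
  set T := sSup A with hT
  have hT0 : 0 ≤ T := le_csSup hbdd h0
  have hT1 : T ≤ 1 := csSup_le ⟨0, h0⟩ fun t ht => ht.1.2
  have hlt : ∀ t, 0 ≤ t → t < T → t ∈ A := by
    intro t ht htT
    obtain ⟨s, hs, hts⟩ := exists_lt_of_lt_csSup ⟨0, h0⟩ htT
    obtain ⟨c, hc⟩ := hs.2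
    exact ⟨⟨ht, htT.le.trans hT1⟩, c, hc.mono (Icc_subset_Icc_right hts.le)⟩
  -- a lift up to a time close to `T`, ending in the domain of a local inverse around `γ T`
  obtain ⟨e, he, t₀, ht₀, c, hc, hce, hsub⟩ : ∃ e : OpenPartialHomeomorph X Y, f = e ∧
      ∃ t₀ ∈ Icc 0 T, ∃ c, IsLiftOn f γ x (Icc 0 t₀) c ∧ c t₀ ∈ e.source ∧
        ∃ T' > T, Icc t₀ T' ⊆ γ ⁻¹' e.target := by
    rcases hT0.eq_or_lt with h | h
    · obtain ⟨e, hxe, he⟩ := hf x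
      obtain ⟨c, hc⟩ := h0.2
      have hmem : γ ⁻¹' e.target ∈ 𝓝 (0 : ℝ) :=
        (e.open_target.preimage hγ).mem_nhds (by
          change γ 0 ∈ e.target
          rw [← hx, he]; exact e.map_source hxe)
      obtain ⟨ε, hε, hball⟩ := Metric.mem_nhds_iff.1 hmem
      refine ⟨e, he, 0, ⟨le_rfl, hT0⟩, c, hc, by rwa [hc.zero], ε / 2, by linarith, fun s hs => ?_⟩
      apply hball
      rw [Metric.mem_ball, Real.dist_eq, sub_zero, abs_of_nonneg hs.1]
      linarith [hs.2]
    · have : Nonempty X := ⟨x⟩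
      choose! G hG using fun t (ht : t ∈ A) => ht.2
      -- The diagonal glues the lifts `G s`; by uniqueness it agrees with each of them on `[0, s]`.
      set c : ℝ → X := fun t => G t t with hcdef
      have hcG : ∀ s ∈ A, EqOn c (G s) (Icc 0 s) := by
        intro s hs t ht
        have htA : t ∈ A := ⟨⟨ht.1, ht.2.trans hs.1.2⟩, G s, (hG s hs).mono
          (Icc_subset_Icc_right ht.2)⟩
        exact (hG t htA).eqOn hf ((hG s hs).mono (Icc_subset_Icc_right ht.2))
          (right_mem_Icc.2 ht.1)
      have hc : IsLiftOn f γ x (Ico 0 T) c := by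
        refine ⟨fun t ht => ?_, (hG 0 h0).zero, fun t ht => ?_⟩
        · obtain ⟨s, hts, hsT⟩ := exists_between ht.2
          have hs : s ∈ A := hlt s (ht.1.trans hts.le) hsT
          have hst : Icc 0 s ∈ 𝓝[Ico 0 T] t := by
            have : Iic s ∈ 𝓝[Ico 0 T] t := mem_nhdsWithin_of_mem_nhds (Iic_mem_nhds hts)
            filter_upwards [this, self_mem_nhdsWithin] with u hu hu'
            exact ⟨hu'.1, hu⟩
          have h1 : ContinuousWithinAt c (Icc 0 s) t :=
            (((hG s hs).continuousOn).congr (hcG s hs)) t ⟨ht.1, hts.le⟩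
          exact h1.mono_of_mem_nhdsWithin hst
        · have htA := hlt t ht.1 ht.2
          exact (hG t htA).lifts t (right_mem_Icc.2 ht.1)
      obtain ⟨z, hz⟩ := H T ⟨h, hT1⟩ c hc
      obtain ⟨e, hze, he⟩ := hf z
      have hfz : f z = γ T := by
        have h1 : MapClusterPt (f z) (𝓝[<] T) (f ∘ c) :=
          hz.continuousAt_comp hf.continuous.continuousAt
        have h2 : Tendsto (f ∘ c) (𝓝[<] T) (𝓝 (γ T)) := by
          refine (hγ.continuousAt.mono_left nhdsWithin_le_nhds).congr' ?_
          filter_upwards [Ioo_mem_nhdsLT h] with t ht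
          exact (hc.lifts t ⟨ht.1.le, ht.2⟩).symm
        have : (𝓝 (f z) ⊓ 𝓝 (γ T)).NeBot := NeBot.mono h1 (inf_le_inf_left _ h2)
        exact eq_of_nhds_neBot this
      have hmem : γ ⁻¹' e.target ∈ 𝓝 T :=
        (e.open_target.preimage hγ).mem_nhds (by
          change γ T ∈ e.target
          rw [← hfz, he]; exact e.map_source hze)
      obtain ⟨ε, hε, hball⟩ := Metric.mem_nhds_iff.1 hmem
      -- A cluster point suffices: one time close to `T` at which `c` lies in the source of `e`
      -- allows the continuation by `e.symm ∘ γ`.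
      have hfreq := hz.frequently (e.open_source.mem_nhds hze)
      have hev : ∀ᶠ t in 𝓝[<] T, t ∈ Ioo (max 0 (T - ε)) T :=
        Ioo_mem_nhdsLT (max_lt h (by linarith))
      obtain ⟨t, hte, ht⟩ := (hfreq.and_eventually hev).exists
      have ht0 : 0 ≤ t := (le_max_left _ _).trans ht.1.le
      have htε : T - ε < t := (le_max_right _ _).trans_lt ht.1
      refine ⟨e, he, t, ⟨ht0, ht.2.le⟩, c, hc.mono fun u hu => ⟨hu.1, hu.2.trans_lt ht.2⟩, hte,
        T + ε / 2, by linarith, fun s hs => ?_⟩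
      apply hball
      rw [Metric.mem_ball, Real.dist_eq, abs_lt]
      constructor <;> linarith [hs.1, hs.2]
  obtain ⟨T', hTT', hsub⟩ := hsub
  have hext : IsLiftOn f γ x (Icc 0 T') (fun t => if t ≤ t₀ then c t else e.symm (γ t)) := by
    have hend : c t₀ = e.symm (γ t₀) := by
      rw [← hc.lifts t₀ (right_mem_Icc.2 ht₀.1), he, e.left_inv hce]
    refine ⟨?_, by simp [ht₀.1, hc.zero], fun t ht => ?_⟩
    · have hU : Icc 0 T' = Icc 0 t₀ ∪ Icc t₀ T' :=
        (Icc_union_Icc_eq_Icc ht₀.1 (ht₀.2.trans hTT'.le)).symm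
      rw [hU]
      refine ContinuousOn.union_of_isClosed ?_ ?_ isClosed_Icc isClosed_Icc
      · exact hc.continuousOn.congr fun t ht => by simp [ht.2]
      · refine (e.continuousOn_symm.comp hγ.continuousOn hsub).congr fun t ht => ?_
        rcases ht.1.eq_or_lt with h | h
        · subst h; simp [hend]
        · simp [not_le.2 h]
    · by_cases h : t ≤ t₀
      · simpa [h] using hc.lifts t ⟨ht.1, h⟩
      · simp only [h, if_false]
        rw [he]
        exact e.right_inv (hsub ⟨(not_le.1 h).le, ht.2⟩)
  have hmin : min T' 1 ∈ A :=
    ⟨⟨le_min (hT0.trans hTT'.le) zero_le_one, min_le_right _ _⟩, _,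
      hext.mono (Icc_subset_Icc_right (min_le_left _ _))⟩
  have h1 : (1 : ℝ) ≤ T' := by
    by_contra! h
    have := le_csSup hbdd hmin
    rw [min_eq_left h.le] at this
    linarith
  exact ⟨_, hext.mono (Icc_subset_Icc_right h1)⟩

/-- A local homeomorphism onto a real topological vector space is bijective if segments lift. -/
theorem bijective_of_exists_isLiftOn {V : Type*} [NormedAddCommGroup V] [NormedSpace ℝ V]
    [ConnectedSpace X] {f : X → V} (hf : IsLocalHomeomorph f)
    (H : ∀ x y, ∃ c, IsLiftOn f (fun t => f x + t • (y - f x)) x (Icc 0 1) c) :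
    Function.Bijective f := by
  obtain ⟨x⟩ : Nonempty X := inferInstance
  choose c hc using H x
  -- Joint continuity of the lifted segments makes their endpoints a continuous section of `f`.
  have hcont : Continuous (fun q : unitInterval × V => c q.2 q.1) :=
    hf.continuous_lift (T2Space.isSeparatedMap f)
      ⟨fun q : unitInterval × V => f x + (q.1 : ℝ) • (q.2 - f x), by fun_prop⟩
      (by ext q; exact (hc q.2).lifts q.1 q.1.2)
      (by simpa [(hc _).zero] using continuous_const)
      (fun y => continuousOn_iff_continuous_domRestrict.1 (hc y).continuousOn)
  have hsec : ∀ y, f (c y 1) = y := fun y => by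
    rw [(hc y).lifts 1 (by simp)]; simp
  have hg : Continuous (fun y => c y 1) :=
    hcont.comp (g := fun q : unitInterval × V => c q.2 q.1)
      (f := fun y => ((1 : unitInterval), y)) (by fun_prop)
  have hbase : c (f x) 1 = x := by
    have h1 : IsLiftOn f (fun t => f x + t • (f x - f x)) x (Icc 0 1) (fun _ => x) :=
      ⟨continuousOn_const, rfl, by simp⟩
    exact (hc (f x)).eqOn hf h1 (by simp)
  -- The section after `f`, and the identity, both lift `f` through itself and agree at `x`, so they
  -- coincide on the connected space.
  have key := (T2Space.isSeparatedMap f).eq_of_comp_eq hf.isLocallyInjective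
    (hg.comp hf.continuous) continuous_id (by ext p; simp [hsec]) x hbase
  exact ⟨Function.LeftInverse.injective (g := fun y => c y 1) (congrFun key),
    fun y => ⟨_, hsec y⟩⟩

end PathLifting
end SteadyState

namespace SteadyState

/-! ### The inverse function theorem on manifolds. -/

section InverseFunctionTheorem

open Set Filter Topology

variable {E V : Type*} [NormedAddCommGroup E] [NormedSpace ℝ E] [FiniteDimensional ℝ E]
  [NormedAddCommGroup V] [NormedSpace ℝ V] [FiniteDimensional ℝ V]
  {M : Type*} [TopologicalSpace M] [ChartedSpace E M] [IsManifold 𝓘(ℝ, E) ∞ M]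

/-- Inverse function theorem for a smooth map of a manifold to a vector space of the same
dimension. -/
theorem isLocalDiffeomorphAt_of_injective_mfderiv {F : M → V}
    (hF : ContMDiff 𝓘(ℝ, E) 𝓘(ℝ, V) ∞ F) (hdim : Module.finrank ℝ E = Module.finrank ℝ V)
    {x : M} (hinj : Function.Injective (mfderiv 𝓘(ℝ, E) 𝓘(ℝ, V) F x)) :
    IsLocalDiffeomorphAt 𝓘(ℝ, E) 𝓘(ℝ, V) ∞ F x := by
  have : CompleteSpace E := FiniteDimensional.complete ℝ E
  set φ := chartAt E x with hφ
  set f : E → V := F ∘ φ.symm with hf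
  have hxs : x ∈ φ.source := mem_chart_source E x
  have hyt : φ x ∈ φ.target := φ.map_source hxs
  have hfs : ContDiffOn ℝ ∞ f φ.target :=
    (hF.comp_contMDiffOn (contMDiffOn_chart_symm (I := 𝓘(ℝ, E)) (x := x) (n := ∞))).contDiffOn
  have hfd : mfderiv 𝓘(ℝ, E) 𝓘(ℝ, V) F x = fderiv ℝ f (φ x) := by
    have h := (hF.mdifferentiable (by simp)) x
    rw [h.mfderiv]
    simp only [writtenInExtChartAt, hf, hφ, mfld_simps, fderivWithin_univ]
    rfl
  have hinj' : Function.Injective (fderiv ℝ f (φ x)) := by rw [← hfd]; exact hinj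
  let A : E ≃L[ℝ] V :=
    (LinearEquiv.ofInjectiveOfFinrankEq (fderiv ℝ f (φ x) : E →ₗ[ℝ] V) hinj' hdim).toContinuousLinearEquiv
  have hA : (A : E →L[ℝ] V) = fderiv ℝ f (φ x) := by ext v; rfl
  have hfat : ContDiffAt ℝ ∞ f (φ x) := hfs.contDiffAt (φ.open_target.mem_nhds hyt)
  have hder : HasFDerivAt f (A : E →L[ℝ] V) (φ x) := by
    rw [hA]; exact (hfat.differentiableAt (by simp)).hasFDerivAt
  set g := hfat.toOpenPartialHomeomorph f hder (by simp) with hg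
  have hgf : (g : E → V) = f := hfat.toOpenPartialHomeomorph_coe hder (by simp)
  have hyg : φ x ∈ g.source := hfat.mem_toOpenPartialHomeomorph_source hder (by simp)
  -- On `W` the derivative is invertible at every point, so the local inverse is smooth on the whole
  -- restricted target and not only at the image of `x`.
  set W : Set E := φ.target ∩ fderiv ℝ f ⁻¹' range ((↑) : (E ≃L[ℝ] V) → E →L[ℝ] V) with hW
  have hWo : IsOpen W :=
    (hfs.continuousOn_fderiv_of_isOpen φ.open_target (by simp)).isOpen_inter_preimage
      φ.open_target ContinuousLinearEquiv.isOpen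
  have hyW : φ x ∈ W := ⟨hyt, A, hA⟩
  set Ψ := φ.trans (g.restrOpen W hWo) with hΨ
  refine ⟨⟨Ψ.toPartialEquiv, Ψ.open_source, Ψ.open_target, ?_, ?_⟩, ?_, ?_⟩
  · refine hF.contMDiffOn.congr fun z hz => ?_
    have hz' : z ∈ φ.source := by simp [hΨ] at hz; exact hz.1
    simp [hΨ, hgf, hf, φ.left_inv hz']
  · have h1 : ContMDiffOn 𝓘(ℝ, V) 𝓘(ℝ, E) ∞ g.symm Ψ.target := by
      rw [contMDiffOn_iff_contDiffOn]
      intro z hz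
      have hz' : z ∈ g.target ∧ g.symm z ∈ W := by
        simp [hΨ] at hz
        tauto
      obtain ⟨B, hB⟩ := hz'.2.2
      have hd : ContDiffAt ℝ ∞ f (g.symm z) :=
        hfs.contDiffAt (φ.open_target.mem_nhds hz'.2.1)
      have := g.contDiffAt_symm (f₀' := B) hz'.1
        (by rw [hgf, hB]; exact (hd.differentiableAt (by simp)).hasFDerivAt) (by rwa [hgf])
      exact this.contDiffWithinAt
    refine (contMDiffOn_chart_symm (I := 𝓘(ℝ, E)) (x := x) (n := ∞)).comp h1 fun z hz => ?_
    simp [hΨ] at hz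
    have : g.symm z ∈ W := by tauto
    exact this.1
  · change x ∈ Ψ.source
    simp [hΨ, hxs, hyg, hyW]
  · intro z hz
    have hz' : z ∈ φ.source := by
      change z ∈ Ψ.source at hz
      simp [hΨ] at hz; exact hz.1
    change F z = Ψ z
    simp [hΨ, hgf, hf, φ.left_inv hz']

end InverseFunctionTheorem

/-! ### Expanding local diffeomorphisms from a complete manifold to a vector space. -/

section Expanding

open Set Filter Topology Manifold

variable {E V H : Type*} [NormedAddCommGroup E] [NormedSpace ℝ E] [TopologicalSpace H]
  {I : ModelWithCorners ℝ E H} [NormedAddCommGroup V] [NormedSpace ℝ V]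
  {M : Type*} [TopologicalSpace M] [ChartedSpace H M]

/-- Continuous lifts of smooth maps along local diffeomorphisms are smooth. -/
theorem IsLocalDiffeomorph.contMDiffOn_lift {F : M → V} {k : ℕ∞ω}
    (hF : IsLocalDiffeomorph I 𝓘(ℝ, V) k F) {γ : ℝ → V} (hγ : ContDiff ℝ k γ) {s : Set ℝ}
    {c : ℝ → M} (hc : ContinuousOn c s) (hlift : ∀ t ∈ s, F (c t) = γ t) :
    ContMDiffOn 𝓘(ℝ, ℝ) I k c s := by
  intro t ht
  have h1 : ContMDiffAt 𝓘(ℝ, V) I k (hF (c t)).localInverse (γ t) := by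
    rw [← hlift t ht]; exact (hF (c t)).localInverse_contMDiffAt
  refine ((h1.comp t hγ.contMDiff.contMDiffAt).contMDiffWithinAt (s := s)).congr_of_eventuallyEq
    ?_ ?_
  · have := (hc t ht).eventually ((hF (c t)).localInverse_eventuallyEq_left)
    filter_upwards [this, self_mem_nhdsWithin] with u hu hus
    simpa [hlift u hus] using hu.symm
  · simpa [hlift t ht] using ((hF (c t)).localInverse_eventuallyEq_left).self_of_nhds.symm

/-- The inverse of an injective local diffeomorphism is smooth. -/
theorem contMDiff_of_rightInverse {F : M → V} {k : ℕ∞ω} (hF : IsLocalDiffeomorph I 𝓘(ℝ, V) k F)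
    (hinj : Function.Injective F) {g : V → M} (hg : ∀ y, F (g y) = y) :
    ContMDiff 𝓘(ℝ, V) I k g := by
  intro y
  have h1 := (hF (g y)).localInverse_contMDiffAt
  have h2 := (hF (g y)).localInverse_eventuallyEq_right
  rw [hg] at h1 h2
  refine h1.congr_of_eventuallyEq ?_
  filter_upwards [h2] with z hz
  exact hinj ((hg z).trans hz.symm)

variable [∀ x : M, ENorm (TangentSpace I x)] [∀ x : M, ENormSMulClass ℝ (TangentSpace I x)]

/-- A lift of an affine path along a map that shrinks no tangent vector by more than the factor
`K` is Lipschitz. -/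
theorem riemannianEDist_lift_le {F : M → V} (hF : IsLocalDiffeomorph I 𝓘(ℝ, V) ∞ F) {K : ENNReal}
    (hK : ∀ (p : M) (v : TangentSpace I p),
      ‖v‖ₑ ≤ K * enorm (E := V) (mfderiv I 𝓘(ℝ, V) F p v))
    {y w : V} {c : ℝ → M} {s t : ℝ} (hst : s ≤ t) (hc : ContinuousOn c (Icc s t))
    (hlift : ∀ u ∈ Icc s t, F (c u) = y + u • w) :
    riemannianEDist I (c s) (c t) ≤ K * ‖w‖ₑ * ENNReal.ofReal (t - s) := by
  have hγ : ContDiff ℝ ∞ (fun u : ℝ => y + u • w) := by fun_prop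
  have hcs := IsLocalDiffeomorph.contMDiffOn_lift hF hγ hc hlift
  refine (riemannianEDist_le_pathELength (hcs.of_le (by simp)) rfl rfl hst).trans ?_
  rw [pathELength_eq_lintegral_mfderiv_Ioo]
  have hbound : ∀ u ∈ Ioo s t, ‖mfderiv 𝓘(ℝ, ℝ) I c u 1‖ₑ ≤ K * ‖w‖ₑ := by
    intro u hu
    refine (hK _ _).trans_eq ?_
    have hcu : MDifferentiableAt 𝓘(ℝ, ℝ) I c u :=
      (hcs.contMDiffAt (Icc_mem_nhds hu.1 hu.2)).mdifferentiableAt (by simp)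
    have hFu : MDifferentiableAt I 𝓘(ℝ, V) F (c u) := (hF (c u)).mdifferentiableAt (by simp)
    have hcomp : mfderiv 𝓘(ℝ, ℝ) 𝓘(ℝ, V) (F ∘ c) u
        = mfderiv 𝓘(ℝ, ℝ) 𝓘(ℝ, V) (fun u : ℝ => y + u • w) u := by
      apply Filter.EventuallyEq.mfderiv_eq
      filter_upwards [Icc_mem_nhds hu.1 hu.2] with r hr using hlift r hr
    rw [mfderiv_comp u hFu hcu, mfderiv_eq_fderiv] at hcomp
    have h2 : fderiv ℝ (fun u : ℝ => y + u • w) u 1 = w := by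
      have : HasDerivAt (fun u : ℝ => y + u • w) w u := by
        simpa using ((hasDerivAt_id u).smul_const w).const_add y
      exact this.deriv
    have h3 := DFunLike.congr_fun hcomp (1 : ℝ)
    exact congrArg (fun v : V => K * ‖v‖ₑ) (h3.trans h2)
  calc _ ≤ ∫⁻ _ in Ioo s t, K * ‖w‖ₑ := MeasureTheory.setLIntegral_mono' measurableSet_Ioo hbound
    _ = _ := by simp

/-- A local diffeomorphism to a vector space which shrinks no tangent vector by more than a
constant factor is bijective if its domain is complete. -/
theorem bijective_of_expanding [T2Space M] [ConnectedSpace M] {F : M → V}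
    (hF : IsLocalDiffeomorph I 𝓘(ℝ, V) ∞ F) {K : ENNReal} (hKtop : K ≠ ⊤)
    (hK : ∀ (p : M) (v : TangentSpace I p),
      ‖v‖ₑ ≤ K * enorm (E := V) (mfderiv I 𝓘(ℝ, V) F p v))
    (hcomplete : ∀ u : ℕ → M,
      (∀ ε : ENNReal, 0 < ε → ∃ N : ℕ, ∀ k ≥ N, ∀ l ≥ N, riemannianEDist I (u k) (u l) < ε) →
      ∃ p : M, Tendsto u atTop (𝓝 p)) :
    Function.Bijective F := by
  refine bijective_of_exists_isLiftOn hF.isLocalHomeomorph fun x y =>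
    exists_isLiftOn_Icc hF.isLocalHomeomorph (by fun_prop) (by simp) fun T hT c hc => ?_
  -- The partial lift is Lipschitz, so it maps times increasing to `T` to a Cauchy sequence; its
  -- limit is the required cluster point.
  obtain ⟨t, -, htT, htlim⟩ := exists_seq_strictMono_tendsto' hT.1
  have hle : ∀ r ∈ Ioo 0 T, ∀ s ∈ Ioo 0 T, r ≤ s →
      riemannianEDist I (c r) (c s) ≤ K * ‖y - F x‖ₑ * ENNReal.ofReal (s - r) := by
    intro r hr s hs hrs
    have hsub : Icc r s ⊆ Ico 0 T := fun u hu => ⟨hr.1.le.trans hu.1, hu.2.trans_lt hs.2⟩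
    exact riemannianEDist_lift_le hF hK hrs (hc.continuousOn.mono hsub)
      fun u hu => hc.lifts u (hsub hu)
  have hdist : ∀ r ∈ Ioo 0 T, ∀ s ∈ Ioo 0 T,
      riemannianEDist I (c r) (c s) ≤ K * ‖y - F x‖ₑ * edist r s := by
    intro r hr s hs
    rw [edist_dist, Real.dist_eq]
    rcases le_total r s with h | h
    · rw [abs_sub_comm, abs_of_nonneg (sub_nonneg.2 h)]
      exact hle r hr s hs h
    · rw [abs_of_nonneg (sub_nonneg.2 h), riemannianEDist_comm]
      exact hle s hs r hr h
  have hC : K * ‖y - F x‖ₑ ≠ ⊤ := ENNReal.mul_ne_top hKtop enorm_ne_top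
  obtain ⟨z, hz⟩ := hcomplete (c ∘ t) fun ε hε => by
    have hcau := EMetric.cauchySeq_iff.1 htlim.cauchySeq
    obtain ⟨δ, hδ, hδε⟩ : ∃ δ : ENNReal, 0 < δ ∧ K * ‖y - F x‖ₑ * δ < ε := by
      have h1 : Tendsto (fun δ : ENNReal => K * ‖y - F x‖ₑ * δ) (𝓝 0) (𝓝 0) := by
        simpa using ENNReal.Tendsto.const_mul (a := K * ‖y - F x‖ₑ) (tendsto_id (x := 𝓝 0))
          (Or.inr hC)
      have h2 := (h1.eventually (gt_mem_nhds hε)).filter_mono (nhdsWithin_le_nhds (s := Ioi 0))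
      obtain ⟨δ, h3, h4⟩ := (h2.and self_mem_nhdsWithin).exists
      exact ⟨δ, h4, h3⟩
    obtain ⟨N, hN⟩ := hcau δ hδ
    refine ⟨N, fun k hk l hl => (hdist _ (htT k) _ (htT l)).trans_lt (lt_of_le_of_lt ?_ hδε)⟩
    gcongr
    exact (hN k hk l hl).le
  refine ⟨z, MapClusterPt.of_comp (φ := t) (p := atTop) ?_ hz.mapClusterPt⟩
  exact tendsto_nhdsWithin_iff.2 ⟨htlim, Eventually.of_forall fun k => (htT k).2⟩

end Expanding
end SteadyState

noncomputable section

namespace SteadyState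

/-! ### Algebra and calculus of the Lorentzian form. -/

section Lorentz

variable {n : ℕ}

theorem lorentz_eq_inner (x y : Mink n) : lorentz x y = inner ℝ x y - 2 * (x 0 * y 0) := by
  rw [PiLp.inner_apply, Fin.sum_univ_succ]
  simp only [lorentz, RCLike.inner_apply, conj_trivial]
  rw [Finset.sum_congr rfl fun (i : Fin (n + 1)) _ => mul_comm (x i.succ) (y i.succ)]
  ring

theorem lorentz_comm (x y : Mink n) : lorentz x y = lorentz y x := by
  simp only [lorentz_eq_inner, real_inner_comm, mul_comm]

@[simp] theorem lorentz_add_left (x y z : Mink n) :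
    lorentz (x + y) z = lorentz x z + lorentz y z := by
  simp only [lorentz_eq_inner, inner_add_left, PiLp.add_apply]; ring

@[simp] theorem lorentz_smul_left (c : ℝ) (x z : Mink n) :
    lorentz (c • x) z = c * lorentz x z := by
  simp only [lorentz_eq_inner, inner_smul_left, PiLp.smul_apply, smul_eq_mul, conj_trivial]; ring

@[simp] theorem lorentz_add_right (x y z : Mink n) :
    lorentz x (y + z) = lorentz x y + lorentz x z := by
  simp only [lorentz_comm x, lorentz_add_left]

@[simp] theorem lorentz_smul_right (c : ℝ) (x z : Mink n) :
    lorentz x (c • z) = c * lorentz x z := by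
  simp only [lorentz_comm x, lorentz_smul_left]

@[simp] theorem lorentz_neg_left (x z : Mink n) : lorentz (-x) z = -lorentz x z := by
  simpa using lorentz_smul_left (-1) x z

@[simp] theorem lorentz_neg_right (x z : Mink n) : lorentz x (-z) = -lorentz x z := by
  simpa using lorentz_smul_right (-1) x z

@[simp] theorem lorentz_sub_left (x y z : Mink n) :
    lorentz (x - y) z = lorentz x z - lorentz y z := by
  simp [sub_eq_add_neg]

@[simp] theorem lorentz_sub_right (x y z : Mink n) :
    lorentz x (y - z) = lorentz x y - lorentz x z := by
  simp [sub_eq_add_neg]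

/-- The Lorentzian metric as a continuous bilinear form. -/
def lorentzForm (n : ℕ) : Mink n →L[ℝ] Mink n →L[ℝ] ℝ :=
  LinearMap.toContinuousBilinearMap
    (LinearMap.mk₂ ℝ lorentz lorentz_add_left lorentz_smul_left lorentz_add_right
      lorentz_smul_right)

@[simp] theorem lorentzForm_apply (x y : Mink n) : lorentzForm n x y = lorentz x y := rfl

@[fun_prop]
theorem contDiff_lorentz {F : Type*} [NormedAddCommGroup F] [NormedSpace ℝ F] {k : ℕ∞ω}
    {f g : F → Mink n} (hf : ContDiff ℝ k f) (hg : ContDiff ℝ k g) :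
    ContDiff ℝ k (fun x => lorentz (f x) (g x)) :=
  ((lorentzForm n).contDiff.comp hf).clm_apply hg

theorem HasDerivAt.lorentz {f g : ℝ → Mink n} {f' g' : Mink n} {t : ℝ} (hf : HasDerivAt f f' t)
    (hg : HasDerivAt g g' t) :
    HasDerivAt (fun s => lorentz (f s) (g s)) (lorentz f' (g t) + lorentz (f t) g') t := by
  have h := ((lorentzForm n).hasFDerivAt.comp_hasDerivAt t hf).clm_apply hg
  exact h

theorem lorentz_e₀ (x : Mink n) : lorentz x (e₀ n) = -x 0 := by
  rw [lorentz_eq_inner, e₀, EuclideanSpace.inner_single_right]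
  simp; ring

end Lorentz

/-! ### Null frames and horospherical coordinates. -/

/-- A splitting of the Lorentz–Minkowski space into the null plane spanned by `a` and `b` and a
Euclidean space of dimension `n`. -/
structure NullFrame {n : ℕ} (a : Mink n) where
  /-- the null vector conjugate to `a` -/
  b : Mink n
  /-- the projection to the Euclidean factor -/
  proj : Mink n →L[ℝ] EuclideanSpace ℝ (Fin n)
  /-- the inclusion of the Euclidean factor -/
  incl : EuclideanSpace ℝ (Fin n) →L[ℝ] Mink n
  lorentz_a_a : lorentz a a = 0
  lorentz_a_b : lorentz a b = 1
  lorentz_b_b : lorentz b b = 0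
  proj_a : proj a = 0
  proj_b : proj b = 0
  proj_incl : ∀ w, proj (incl w) = w
  lorentz_incl_a : ∀ w, lorentz (incl w) a = 0
  lorentz_incl_b : ∀ w, lorentz (incl w) b = 0
  lorentz_incl_incl : ∀ w w', lorentz (incl w) (incl w') = inner ℝ w w'
  decomp : ∀ x, x = incl (proj x) + lorentz x b • a + lorentz x a • b

/-- The plane `U` spanned by `e₀` and `a` contains a second null line. Since `e₀ ∈ U`, vectors of
the Euclidean complement of `U` have zero time component, so their Lorentzian and Euclidean products
with any vector agree; this complement is the Euclidean factor. -/
theorem exists_nullFrame {n : ℕ} {a : Mink n} (ha : IsPastNull a) : Nonempty (NullFrame a) := by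
  obtain ⟨haa, hae⟩ := ha
  rw [lorentz_e₀] at hae
  have hr : a 0 ≠ 0 := by linarith
  set r := a 0 with hrdef
  have he0 : e₀ n 0 = 1 := by simp [e₀]
  have hee : lorentz (e₀ n) (e₀ n) = -1 := by rw [lorentz_e₀, he0]
  have hea : lorentz a (e₀ n) = -r := lorentz_e₀ a
  have hae' : lorentz (e₀ n) a = -r := by rw [lorentz_comm, hea]
  -- `2r e₀ - a` is `a` with its spatial part reversed, hence null; its product with `a` is `-2r²`,
  -- which fixes the factor.
  set b : Mink n := (-(1 / (2 * r ^ 2))) • ((2 * r) • e₀ n - a) with hb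
  have hab : lorentz a b = 1 := by
    simp [hb, haa, hea]; field_simp
  have hbb : lorentz b b = 0 := by
    simp only [hb, lorentz_smul_left, lorentz_smul_right, lorentz_sub_left, lorentz_sub_right,
      haa, hea, hae', hee]
    ring
  set U : Submodule ℝ (Mink n) := Submodule.span ℝ {e₀ n, a} with hU
  have haU : a ∈ U := Submodule.subset_span (by simp)
  have heU : e₀ n ∈ U := Submodule.subset_span (by simp)
  have hbU : b ∈ U := U.smul_mem _ (U.sub_mem (U.smul_mem _ heU) haU)
  have hfr : Module.finrank ℝ Uᗮ = n := by
    have hli : LinearIndependent ℝ ![e₀ n, a] := by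
      rw [LinearIndependent.pair_iff]
      intro s t hst
      have h1 : lorentz (s • e₀ n + t • a) a = 0 := by rw [hst]; simpa using lorentz_smul_left 0 0 a
      simp only [lorentz_add_left, lorentz_smul_left, hae', haa, mul_zero, add_zero] at h1
      have hs : s = 0 := by
        rcases mul_eq_zero.1 h1 with h | h
        · exact h
        · exact absurd (neg_eq_zero.1 h) hr
      have h2 := congrArg (fun x : Mink n => x 0) hst
      simp [hs] at h2
      exact ⟨hs, h2.resolve_right hr⟩
    have h2 : Module.finrank ℝ U = 2 := by
      have := finrank_span_eq_card hli
      rwa [Matrix.range_cons_cons_empty, Fintype.card_fin] at this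
    have h3 := Submodule.finrank_add_finrank_orthogonal U
    rw [h2, finrank_euclideanSpace, Fintype.card_fin] at h3
    omega
  let ι : Uᗮ ≃ₗᵢ[ℝ] EuclideanSpace ℝ (Fin n) :=
    ((stdOrthonormalBasis ℝ Uᗮ).reindex (finCongr hfr)).repr
  have hW0 : ∀ w : Uᗮ, (w : Mink n) 0 = 0 := fun w => by
    have := Submodule.inner_left_of_mem_orthogonal heU w.2
    rw [e₀, EuclideanSpace.inner_single_right] at this
    simpa using this
  have hWin : ∀ (w : Uᗮ) (x : Mink n), lorentz w x = inner ℝ (w : Mink n) x := fun w x => by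
    rw [lorentz_eq_inner, hW0]; ring
  have hWU : ∀ (w : Uᗮ), ∀ x ∈ U, lorentz (w : Mink n) x = 0 := fun w x hx => by
    rw [hWin]; exact Submodule.inner_left_of_mem_orthogonal hx w.2
  have he : e₀ n = (1 / (2 * r)) • a - r • b := by
    rw [hb]
    match_scalars <;> field_simp <;> ring
  have hdec : ∀ x : Mink n, ∃ α β : ℝ, x = (Uᗮ.orthogonalProjectionOnto x : Mink n) + α • a + β • b := by
    intro x
    have h1 : x - Uᗮ.orthogonalProjectionOnto x ∈ U := by
      have := Submodule.sub_starProjection_mem_orthogonal (K := Uᗮ) x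
      rwa [Submodule.orthogonal_orthogonal, Submodule.starProjection_apply] at this
    obtain ⟨s, t, hst⟩ := Submodule.mem_span_pair.1 h1
    refine ⟨t + s / (2 * r), -(s * r), ?_⟩
    rw [he] at hst
    rw [add_assoc, ← sub_eq_iff_eq_add', ← hst]
    match_scalars <;> field_simp <;> ring
  refine ⟨⟨b, ι.toContinuousLinearEquiv.toContinuousLinearMap ∘L Uᗮ.orthogonalProjectionOnto,
    Uᗮ.subtypeL ∘L ι.symm.toContinuousLinearEquiv.toContinuousLinearMap,
    haa, hab, hbb, ?_, ?_, ?_, ?_, ?_, ?_, ?_⟩⟩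
  · simp [Submodule.orthogonalProjectionOnto_orthogonal_apply_eq_zero haU]
  · simp [Submodule.orthogonalProjectionOnto_orthogonal_apply_eq_zero hbU]
  · intro w; simp
  · intro w; exact hWU _ a haU
  · intro w; exact hWU _ b hbU
  · intro w w'
    refine (hWin _ _).trans ?_
    exact ι.symm.inner_map_map w w'
  · intro x
    obtain ⟨α, β, h⟩ := hdec x
    have hα : lorentz x b = α := by
      rw [h, lorentz_add_left, lorentz_add_left, hWU _ b hbU]; simp [hab, hbb]
    have hβ : lorentz x a = β := by
      rw [h, lorentz_add_left, lorentz_add_left, hWU _ a haU]; simp [haa, lorentz_comm b a, hab]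
    rw [hα, hβ]
    simpa using h

namespace NullFrame

variable {n : ℕ} {a : Mink n} (N : NullFrame a)

theorem lorentz_eq (x y : Mink n) : lorentz x y =
    inner ℝ (N.proj x) (N.proj y) + lorentz x a * lorentz y N.b + lorentz x N.b * lorentz y a := by
  have hia := fun w => (lorentz_comm a (N.incl w)).trans (N.lorentz_incl_a w)
  have hib := fun w => (lorentz_comm N.b (N.incl w)).trans (N.lorentz_incl_b w)
  conv_lhs => rw [N.decomp x, N.decomp y]
  simp only [lorentz_add_left, lorentz_add_right, lorentz_smul_left, lorentz_smul_right,
    N.lorentz_incl_incl, N.lorentz_incl_a, N.lorentz_incl_b, hia, hib, N.lorentz_a_a,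
    N.lorentz_a_b, N.lorentz_b_b, lorentz_comm N.b a]
  ring

/-- The horospherical parametrization of the leaf `L₁`. -/
def param (w : EuclideanSpace ℝ (Fin n)) : Mink n :=
  N.incl w + ((1 - ‖w‖ ^ 2) / 2) • a + N.b

theorem contDiff_param : ContDiff ℝ ∞ N.param := by
  unfold param
  have := contDiff_norm_sq ℝ (E := EuclideanSpace ℝ (Fin n)) (n := ∞)
  fun_prop

theorem proj_param (w : EuclideanSpace ℝ (Fin n)) : N.proj (N.param w) = w := by
  simp [param, N.proj_incl, N.proj_a, N.proj_b]

theorem param_mem_leaf (w : EuclideanSpace ℝ (Fin n)) : N.param w ∈ leaf a 1 := by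
  have hia := fun w => (lorentz_comm a (N.incl w)).trans (N.lorentz_incl_a w)
  have hib := fun w => (lorentz_comm N.b (N.incl w)).trans (N.lorentz_incl_b w)
  have h1 : lorentz (N.param w) a = 1 := by
    simp [param, N.lorentz_incl_a, N.lorentz_a_a, lorentz_comm N.b a, N.lorentz_a_b]
  refine ⟨⟨?_, by rw [h1]; exact one_pos⟩, h1⟩
  change lorentz _ _ = 1
  simp only [param, lorentz_add_left, lorentz_add_right, lorentz_smul_left, lorentz_smul_right,
    N.lorentz_incl_incl, N.lorentz_incl_a, N.lorentz_incl_b, hia, hib, N.lorentz_a_a,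
    N.lorentz_a_b, N.lorentz_b_b, lorentz_comm N.b a, real_inner_self_eq_norm_sq]
  ring

/-- On `L₁` the equation `⟨q, q⟩ = 1` reads `|w|² + 2⟨q, b⟩ = 1`, so the Euclidean part `w`
determines the coefficient of `a`. -/
theorem param_proj {q : Mink n} (hq : q ∈ leaf a 1) : N.param (N.proj q) = q := by
  have h1 : lorentz q q = 1 := hq.1.1
  have h2 : lorentz q a = 1 := hq.2
  rw [N.lorentz_eq, h2, real_inner_self_eq_norm_sq] at h1
  conv_rhs => rw [N.decomp q, h2, one_smul]
  have : (1 - ‖N.proj q‖ ^ 2) / 2 = lorentz q N.b := by linarith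
  rw [param, this]

/-- The horospherical coordinate on `ℋⁿ⁺¹`. -/
def coord (x : Mink n) : EuclideanSpace ℝ (Fin n) := (lorentz x a)⁻¹ • N.proj x

end NullFrame

/-- The orthogonal geodesic projection of `ℋⁿ⁺¹` to `L₁`. -/
def leafProj {n : ℕ} (a x : Mink n) : Mink n :=
  (lorentz x a)⁻¹ • x + ((1 - (lorentz x a)⁻¹ ^ 2) / 2) • a

theorem leafProj_mem_leaf {n : ℕ} {a x : Mink n} (ha : lorentz a a = 0) (hx : x ∈ space a) :
    leafProj a x ∈ leaf a 1 := by
  have h1 : lorentz x x = 1 := hx.1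
  have h2 : lorentz x a ≠ 0 := hx.2.ne'
  have h3 : lorentz (leafProj a x) a = 1 := by simp [leafProj, ha, h2]
  refine ⟨⟨?_, by rw [h3]; exact one_pos⟩, h3⟩
  change lorentz _ _ = 1
  simp only [leafProj, lorentz_add_left, lorentz_add_right, lorentz_smul_left, lorentz_smul_right,
    ha, h1, lorentz_comm a x]
  field_simp
  ring

/-- `leafProj a x` and `x / ⟨x, a⟩` differ by a multiple of `a`, which `proj` kills, and a point of
`L₁` is determined by its Euclidean part. -/
theorem NullFrame.param_coord {n : ℕ} {a : Mink n} (N : NullFrame a) {x : Mink n}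
    (hx : x ∈ space a) : N.param (N.coord x) = leafProj a x := by
  rw [← N.param_proj (leafProj_mem_leaf N.lorentz_a_a hx)]
  congr 1
  simp [coord, leafProj, N.proj_a]

end SteadyState
end

noncomputable section

namespace SteadyState

/-! ### Geodesics orthogonal to the leaf `L₁`. -/

section Geodesics

variable {n : ℕ} {a q x : Mink n}

/-- The geodesic that meets the leaf `L₁` orthogonally at `q`. -/
def orthogonalGeodesic (a q : Mink n) (t : ℝ) : Mink n := Real.exp t • q - Real.sinh t • a

theorem hasDerivAt_orthogonalGeodesic (a q : Mink n) (t : ℝ) :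
    HasDerivAt (orthogonalGeodesic a q) (Real.exp t • q - Real.cosh t • a) t :=
  ((Real.hasDerivAt_exp t).smul_const q).sub ((Real.hasDerivAt_sinh t).smul_const a)

/-- The vector `z = q - a` is unit timelike with `⟨z, a⟩ = 1`. If it were not future-pointing, then
`z₀ a₀ ≥ 0`, and Cauchy–Schwarz on the spatial parts would give `(1 + z₀ a₀)² ≤ (z₀² - 1) a₀²`,
which is impossible. -/
theorem lorentz_sub_e₀_neg (ha : IsPastNull a) (hq : q ∈ leaf a 1) :
    lorentz (q - a) (e₀ n) < 0 := by
  obtain ⟨haa, hae⟩ := ha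
  have hqq : lorentz q q = 1 := hq.1.1
  have hqa : lorentz q a = 1 := hq.2
  rw [lorentz_e₀] at hae ⊢
  set z := q - a with hz
  have hzz : lorentz z z = -1 := by simp [hz, hqq, hqa, haa, lorentz_comm a q]
  have hza : lorentz z a = 1 := by simp [hz, hqa, haa]
  have hcs := Finset.sum_mul_sq_le_sq_mul_sq Finset.univ
    (fun i : Fin (n + 1) => z i.succ) (fun i => a i.succ)
  simp only [lorentz, ← pow_two] at hzz hza haa
  by_contra! h
  have h1 : ∑ i : Fin (n + 1), z i.succ ^ 2 = z 0 ^ 2 - 1 := by linarith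
  have h2 : ∑ i : Fin (n + 1), a i.succ ^ 2 = a 0 ^ 2 := by linarith
  have h3 : ∑ i : Fin (n + 1), z i.succ * a i.succ = 1 + z 0 * a 0 := by linarith
  rw [h1, h2, h3] at hcs
  have h4 : 0 ≤ z 0 * a 0 := mul_nonneg_of_nonpos_of_nonpos (by linarith) (by linarith)
  nlinarith [sq_nonneg (a 0)]

theorem isOrthogonalGeodesic_orthogonalGeodesic (ha : IsPastNull a) (hq : q ∈ leaf a 1) :
    IsOrthogonalGeodesic a q (orthogonalGeodesic a q) := by
  have hqq : lorentz q q = 1 := hq.1.1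
  have hqa : lorentz q a = 1 := hq.2
  have hd : deriv (orthogonalGeodesic a q) = fun t => Real.exp t • q - Real.cosh t • a :=
    funext fun t => (hasDerivAt_orthogonalGeodesic a q t).deriv
  have hd0 : deriv (orthogonalGeodesic a q) 0 = q - a := by simp [hd]
  refine ⟨⟨?_, fun t => ?_, fun t => ⟨1, ?_⟩⟩, by simp [orthogonalGeodesic], ?_, ?_, ?_⟩
  · unfold orthogonalGeodesic
    exact (Real.contDiff_exp.smul contDiff_const).sub (Real.contDiff_sinh.smul contDiff_const)
  · have h1 : lorentz (orthogonalGeodesic a q t) a = Real.exp t := by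
      simp [orthogonalGeodesic, hqa, ha.1]
    refine ⟨?_, by rw [h1]; exact Real.exp_pos t⟩
    change lorentz _ _ = 1
    simp only [orthogonalGeodesic, lorentz_sub_left, lorentz_sub_right, lorentz_smul_left,
      lorentz_smul_right, hqq, hqa, ha.1, lorentz_comm a q, Real.sinh_eq]
    have h2 : Real.exp t * Real.exp (-t) = 1 := by rw [← Real.exp_add]; simp
    linear_combination h2
  · rw [hd, one_smul]
    exact (((Real.hasDerivAt_exp t).smul_const q).sub
      ((Real.hasDerivAt_cosh t).smul_const a)).deriv
  · rw [hd0]; simp [hqq, hqa, ha.1, lorentz_comm a q]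
  · rw [hd0]; exact lorentz_sub_e₀_neg ha hq
  · intro v hv
    rw [hd0, lorentz_sub_left, lorentz_comm q, lorentz_comm a, hv.1, hv.2, sub_zero]

/-- The tangent spaces of the leaves are spacelike. -/
theorem eq_zero_of_mem_leafTangent (N : NullFrame a) (hq : lorentz q a ≠ 0) {u : Mink n}
    (hu : u ∈ leafTangent a q) (huu : lorentz u u = 0) : u = 0 := by
  rw [N.lorentz_eq, hu.2, real_inner_self_eq_norm_sq] at huu
  -- Without a Euclidean part, `u` is a multiple of `a`, and `⟨u, q⟩ = 0` with `⟨q, a⟩ ≠ 0` makes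
  -- the multiple zero.
  have hp : N.proj u = 0 := by simpa using huu
  have hu' := N.decomp u
  rw [hp, hu.2, map_zero, zero_add, zero_smul, add_zero] at hu'
  have h1 : lorentz u q = lorentz u N.b * lorentz a q := by
    conv_lhs => rw [hu', lorentz_smul_left]
  rw [hu.1, lorentz_comm a q] at h1
  have h2 : lorentz u N.b = 0 := by
    rcases mul_eq_zero.1 h1.symm with h | h
    · exact h
    · exact absurd h hq
  rw [hu', h2, zero_smul]

theorem IsGeodesic.lorentz_deriv_self {γ : ℝ → Mink n} (hγ : IsGeodesic a γ) (t : ℝ) :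
    lorentz (deriv γ t) (γ t) = 0 := by
  have h1 : HasDerivAt γ (deriv γ t) t :=
    (hγ.smooth.differentiable (by simp) t).hasDerivAt
  have h2 := HasDerivAt.lorentz h1 h1
  have h3 : (fun s => lorentz (γ s) (γ s)) = fun _ => (1 : ℝ) := funext fun s => (hγ.mem s).1
  rw [h3] at h2
  have h4 := h2.unique (hasDerivAt_const t (1 : ℝ))
  rw [lorentz_comm (γ t)] at h4
  linarith

/-- A unit timelike geodesic satisfies `γ'' = γ`. -/
theorem IsGeodesic.hasDerivAt_deriv {γ : ℝ → Mink n} (hγ : IsGeodesic a γ)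
    (hunit : lorentz (deriv γ 0) (deriv γ 0) = -1) (t : ℝ) : HasDerivAt (deriv γ) (γ t) t := by
  have hd1 : ∀ t, HasDerivAt γ (deriv γ t) t := fun t =>
    (hγ.smooth.differentiable (by simp) t).hasDerivAt
  have hs : ContDiff ℝ ∞ (deriv γ) := (contDiff_infty_iff_deriv.1 hγ.smooth).2
  have hd2 : ∀ t, HasDerivAt (deriv γ) (deriv (deriv γ) t) t := fun t =>
    (hs.differentiable (by simp) t).hasDerivAt
  -- The speed is constant because the acceleration is a multiple of `γ`, which is orthogonal to
  -- `γ'`. Differentiating `⟨γ', γ⟩ = 0` then gives `c - 1 = 0`.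
  have hconst : ∀ t, lorentz (deriv γ t) (deriv γ t) = -1 := by
    intro t
    rw [← hunit]
    refine is_const_of_deriv_eq_zero (f := fun s => lorentz (deriv γ s) (deriv γ s))
      (fun s => (HasDerivAt.lorentz (hd2 s) (hd2 s)).differentiableAt) (fun s => ?_) t 0
    rw [(HasDerivAt.lorentz (hd2 s) (hd2 s)).deriv]
    obtain ⟨c, hc⟩ := hγ.normal s
    rw [hc]
    simp [hγ.lorentz_deriv_self s, lorentz_comm (γ s)]
  obtain ⟨c, hc⟩ := hγ.normal t
  have h1 := HasDerivAt.lorentz (hd2 t) (hd1 t)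
  have h2 : (fun s => lorentz (deriv γ s) (γ s)) = fun _ => (0 : ℝ) :=
    funext hγ.lorentz_deriv_self
  rw [h2] at h1
  have h3 := h1.unique (hasDerivAt_const t (0 : ℝ))
  have h4 : lorentz (γ t) (γ t) = 1 := (hγ.mem t).1
  rw [hc, hconst, lorentz_smul_left, h4] at h3
  have hc1 : c = 1 := by linarith
  have h5 := hd2 t
  rwa [hc, hc1, one_smul] at h5

/-- `cosh • γ - sinh • γ'` and `cosh • γ' - sinh • γ` are first integrals; `cosh² - sinh² = 1`
recovers `γ` from them. -/
theorem eq_of_hasDerivAt_deriv {V : Type*} [NormedAddCommGroup V] [NormedSpace ℝ V] {γ : ℝ → V}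
    (h1 : ∀ t, HasDerivAt γ (deriv γ t) t) (h2 : ∀ t, HasDerivAt (deriv γ) (γ t) t) (t : ℝ) :
    γ t = Real.cosh t • γ 0 + Real.sinh t • deriv γ 0 := by
  have hA : ∀ s, HasDerivAt (fun s => Real.cosh s • γ s - Real.sinh s • deriv γ s) 0 s := by
    intro s
    refine (((Real.hasDerivAt_cosh s).smul (h1 s)).sub
      ((Real.hasDerivAt_sinh s).smul (h2 s))).congr_deriv ?_
    abel
  have hB : ∀ s, HasDerivAt (fun s => Real.cosh s • deriv γ s - Real.sinh s • γ s) 0 s := by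
    intro s
    refine (((Real.hasDerivAt_cosh s).smul (h2 s)).sub
      ((Real.hasDerivAt_sinh s).smul (h1 s))).congr_deriv ?_
    abel
  have hA' := is_const_of_deriv_eq_zero (fun s => (hA s).differentiableAt)
    (fun s => (hA s).deriv) t 0
  have hB' := is_const_of_deriv_eq_zero (fun s => (hB s).differentiableAt)
    (fun s => (hB s).deriv) t 0
  simp only [Real.cosh_zero, Real.sinh_zero, one_smul, zero_smul, sub_zero] at hA' hB'
  rw [← hA', ← hB']
  have := Real.cosh_sq t
  match_scalars
  · linear_combination -this
  · ring

/-- The initial velocity is orthogonal to `q` and to the leaf, hence a multiple `s (q - a)`; unit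
length gives `s = ±1` and the time orientation selects `s = 1`. -/
theorem IsOrthogonalGeodesic.eq_orthogonalGeodesic (ha : IsPastNull a) (hq : q ∈ leaf a 1)
    {γ : ℝ → Mink n} (hγ : IsOrthogonalGeodesic a q γ) : γ = orthogonalGeodesic a q := by
  obtain ⟨N⟩ := exists_nullFrame ha
  have hqq : lorentz q q = 1 := hq.1.1
  have hqa : lorentz q a = 1 := hq.2
  have hvq : lorentz (deriv γ 0) q = 0 := by
    have := hγ.geodesic.lorentz_deriv_self 0
    rwa [hγ.start] at this
  set v := deriv γ 0 with hv
  set s := lorentz v a with hs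
  have hv' : v = s • (q - a) := by
    have hu : v - s • (q - a) ∈ leafTangent a q := by
      constructor
      · simp [hvq, hqq, lorentz_comm a q, hqa]
      · simp [hqa, ha.1, ← hs]
    -- The difference is tangent to the leaf and also orthogonal to it, so it is null and therefore
    -- zero.
    refine sub_eq_zero.1 (eq_zero_of_mem_leafTangent N (by rw [hqa]; exact one_ne_zero) hu ?_)
    have h1 := hγ.orthogonal _ hu
    rw [lorentz_sub_left, h1, lorentz_smul_left, lorentz_sub_left, lorentz_comm q,
      lorentz_comm a, hu.1, hu.2]
    simp
  have hs2 : s ^ 2 = 1 := by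
    have h1 : lorentz v v = -1 := hγ.unit
    rw [hv'] at h1
    simp only [lorentz_smul_left, lorentz_smul_right, lorentz_sub_left, lorentz_sub_right,
      hqq, hqa, ha.1, lorentz_comm a q] at h1
    linarith
  have hs1 : s = 1 := by
    have h1 : lorentz v (e₀ n) < 0 := hγ.future
    rw [hv', lorentz_smul_left] at h1
    have h2 := lorentz_sub_e₀_neg ha hq
    have h3 : 0 < s := by
      by_contra! h
      nlinarith
    nlinarith
  rw [hs1, one_smul] at hv'
  funext t
  rw [eq_of_hasDerivAt_deriv
    (fun t => (hγ.geodesic.smooth.differentiable (by simp) t).hasDerivAt)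
    (hγ.geodesic.hasDerivAt_deriv hγ.unit) t, hγ.start, ← hv, hv', orthogonalGeodesic,
    ← Real.cosh_add_sinh]
  module

/-- Along the geodesic `⟨γ t, a⟩ = eᵗ`, so `x` can only be reached at time `log ⟨x, a⟩`, and `x = eᵗ
q - sinh t a` can be solved for `q`. -/
theorem isGeodesicProjection_iff (ha : IsPastNull a) (hx : x ∈ space a) :
    IsGeodesicProjection a x q ↔ q = leafProj a x := by
  have hτ : 0 < lorentz x a := hx.2
  constructor
  · rintro ⟨hq, γ, hγ, t, rfl⟩
    rw [hγ.eq_orthogonalGeodesic ha hq]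
    have h1 : lorentz (orthogonalGeodesic a q t) a = Real.exp t := by
      simp [orthogonalGeodesic, hq.2, ha.1]
    rw [leafProj, h1, orthogonalGeodesic, Real.sinh_eq, Real.exp_neg]
    have := Real.exp_pos t
    match_scalars <;> field_simp <;> ring
  · rintro rfl
    have hmem := leafProj_mem_leaf ha.1 hx
    refine ⟨hmem, _, isOrthogonalGeodesic_orthogonalGeodesic ha hmem, Real.log (lorentz x a), ?_⟩
    rw [orthogonalGeodesic, leafProj, Real.sinh_eq, Real.exp_neg, Real.exp_log hτ]
    match_scalars <;> field_simp <;> ring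

end Geodesics
end SteadyState
end

noncomputable section

namespace SteadyState

/-! ### The differential of the horospherical coordinate. -/

namespace NullFrame

variable {n : ℕ} {a : Mink n} (N : NullFrame a)

/-- The derivative of the horospherical coordinate at `x`. -/
def coordDeriv (x : Mink n) : Mink n →L[ℝ] EuclideanSpace ℝ (Fin n) :=
  (lorentz x a)⁻¹ • N.proj -
    ((lorentz x a ^ 2)⁻¹ • (lorentzForm n).flip a).smulRight (N.proj x)

theorem coordDeriv_apply (x v : Mink n) : N.coordDeriv x v =
    (lorentz x a)⁻¹ • N.proj v - ((lorentz x a ^ 2)⁻¹ * lorentz v a) • N.proj x := rfl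

theorem contDiffAt_coord {x : Mink n} (hx : lorentz x a ≠ 0) : ContDiffAt ℝ ∞ N.coord x := by
  have h : ContDiff ℝ ∞ (fun x : Mink n => lorentz x a) := by fun_prop
  exact (h.contDiffAt.inv hx).smul N.proj.contDiff.contDiffAt

theorem hasFDerivAt_coord {x : Mink n} (hx : lorentz x a ≠ 0) :
    HasFDerivAt N.coord (N.coordDeriv x) x := by
  have h1 : HasFDerivAt (fun x : Mink n => lorentz x a) ((lorentzForm n).flip a) x :=
    ((lorentzForm n).flip a).hasFDerivAt
  have h2 := ((hasDerivAt_inv hx).comp_hasFDerivAt x h1).smul N.proj.hasFDerivAt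
  refine h2.congr_fderiv ?_
  ext1 v
  simp [coordDeriv_apply]
  abel

/-- This is the metric `τ² |dw|² - τ⁻² dτ²` solved for `|dw|²`; `⟨x, x⟩ = 1` and `⟨v, x⟩ = 0`
eliminate the Euclidean products involving `proj x`. -/
theorem norm_sq_coordDeriv {x v : Mink n} (hx : x ∈ space a) (hv : lorentz v x = 0) :
    ‖N.coordDeriv x v‖ ^ 2 =
      lorentz v v / lorentz x a ^ 2 + lorentz v a ^ 2 / lorentz x a ^ 4 := by
  have hx1 : lorentz x x = 1 := hx.1
  have hτ : lorentz x a ≠ 0 := hx.2.ne'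
  have hvv := N.lorentz_eq v v
  rw [N.lorentz_eq] at hv hx1
  have hxx : inner ℝ (N.proj x) (N.proj x) = 1 - 2 * lorentz x a * lorentz x N.b := by linarith
  have hvx : inner ℝ (N.proj v) (N.proj x) =
      -(lorentz v a * lorentz x N.b + lorentz v N.b * lorentz x a) := by linarith
  rw [coordDeriv_apply, ← real_inner_self_eq_norm_sq, inner_sub_left, inner_sub_right,
    inner_sub_right]
  simp only [inner_smul_left, inner_smul_right, conj_trivial,
    real_inner_comm (N.proj v) (N.proj x), hxx, hvx]
  rw [hvv]
  field_simp
  ring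

end NullFrame

/-! ### Spacelike hypersurfaces in the horospherical coordinate. -/

section Hypersurface

variable {n : ℕ} {S : Type*} [TopologicalSpace S] [ChartedSpace (EuclideanSpace ℝ (Fin n)) S]
  {a : Mink n} {ψ : S → Mink n}

theorem inducedEnormSMulClass (ψ : S → Mink n) (p : S) :
    letI := inducedENorm ψ p
    ENormSMulClass ℝ (TangentSpace (𝓡 n) p) := by
  let := inducedENorm ψ p
  refine ⟨fun r v => ?_⟩
  change ENNReal.ofReal (Real.sqrt (inducedForm ψ p (r • v) (r • v))) =
    ‖r‖ₑ * ENNReal.ofReal (Real.sqrt (inducedForm ψ p v v))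
  have h : inducedForm ψ p (r • v) (r • v) = r ^ 2 * inducedForm ψ p v v := by
    simp only [inducedForm, map_smul, lorentz_smul_left, lorentz_smul_right]; ring
  rw [h, Real.sqrt_mul (sq_nonneg r), Real.sqrt_sq_eq_abs, ENNReal.ofReal_mul (abs_nonneg r),
    Real.enorm_eq_ofReal_abs]

theorem IsSpacelike.lorentz_differential (h : IsSpacelike a ψ) (p : S)
    (v : TangentSpace (𝓡 n) p) : lorentz (differential ψ p v) (ψ p) = 0 := by
  have hd : MDifferentiableAt (𝓡 n) 𝓘(ℝ, Mink n) ψ p := h.smooth.mdifferentiable (by simp) p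
  have h1 : HasFDerivAt (fun x : Mink n => lorentz x x)
      (2 • lorentzForm n (ψ p)) (ψ p) := by
    have := (lorentzForm n).hasFDerivAt.clm_apply (hasFDerivAt_id (ψ p))
    refine this.congr_fderiv ?_
    ext1 w
    simp [lorentz_comm w, two_mul]
  have h2 := h1.hasMFDerivAt.comp p hd.hasMFDerivAt
  have h3 : (fun x : Mink n => lorentz x x) ∘ ψ = fun _ => (1 : ℝ) :=
    funext fun q => (h.mem q).1
  rw [h3] at h2
  have h4 := hasMFDerivAt_unique h2 (hasMFDerivAt_const (1 : ℝ) p)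
  have h5 := DFunLike.congr_fun h4 v
  have h6 : 2 • lorentz (ψ p) (differential ψ p v) = 0 := h5
  rw [lorentz_comm]
  simpa using h6

variable (N : NullFrame a)

theorem IsSpacelike.contMDiff_coord (h : IsSpacelike a ψ) :
    ContMDiff (𝓡 n) 𝓘(ℝ, EuclideanSpace ℝ (Fin n)) ∞ (N.coord ∘ ψ) := fun p =>
  (N.contDiffAt_coord (h.mem p).2.ne').contMDiffAt.comp p (h.smooth p)

theorem IsSpacelike.norm_sq_mfderiv_coord (h : IsSpacelike a ψ) (p : S)
    (v : TangentSpace (𝓡 n) p) :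
    norm (E := EuclideanSpace ℝ (Fin n))
      (mfderiv (𝓡 n) 𝓘(ℝ, EuclideanSpace ℝ (Fin n)) (N.coord ∘ ψ) p v) ^ 2 =
      inducedForm ψ p v v / lorentz (ψ p) a ^ 2
        + lorentz (differential ψ p v) a ^ 2 / lorentz (ψ p) a ^ 4 := by
  have hd : MDifferentiableAt (𝓡 n) 𝓘(ℝ, Mink n) ψ p := h.smooth.mdifferentiable (by simp) p
  have h1 := ((N.hasFDerivAt_coord (h.mem p).2.ne').hasMFDerivAt.comp p hd.hasMFDerivAt).mfderiv
  rw [h1]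
  exact N.norm_sq_coordDeriv (h.mem p) (h.lorentz_differential p v)

/-- The term in `dτ²` has a favourable sign and is dropped. The estimate yields both the injectivity
of the differential and, for bounded `τ`, the expansion property. -/
theorem IsSpacelike.inducedForm_le (h : IsSpacelike a ψ) (p : S) (v : TangentSpace (𝓡 n) p) :
    Real.sqrt (inducedForm ψ p v v) ≤ lorentz (ψ p) a * norm (E := EuclideanSpace ℝ (Fin n))
      (mfderiv (𝓡 n) 𝓘(ℝ, EuclideanSpace ℝ (Fin n)) (N.coord ∘ ψ) p v) := by
  have hτ : 0 < lorentz (ψ p) a := (h.mem p).2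
  refine Real.sqrt_le_iff.2 ⟨mul_nonneg hτ.le (norm_nonneg _), ?_⟩
  rw [mul_pow, h.norm_sq_mfderiv_coord, mul_add, mul_div_cancel₀ _ (by positivity)]
  exact le_add_of_nonneg_right (by positivity)

variable [IsManifold (𝓡 n) ∞ S]

theorem IsSpacelike.isLocalDiffeomorph_coord (h : IsSpacelike a ψ) :
    IsLocalDiffeomorph (𝓡 n) 𝓘(ℝ, EuclideanSpace ℝ (Fin n)) ∞ (N.coord ∘ ψ) := by
  intro p
  refine isLocalDiffeomorphAt_of_injective_mfderiv (h.contMDiff_coord N) rfl ?_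
  rw [injective_iff_map_eq_zero]
  intro v hv
  by_contra hne
  have h1 := h.pos p v hne
  have h2 := h.inducedForm_le N p v
  have h3 : norm (E := EuclideanSpace ℝ (Fin n))
      (mfderiv (𝓡 n) 𝓘(ℝ, EuclideanSpace ℝ (Fin n)) (N.coord ∘ ψ) p v) = 0 :=
    norm_eq_zero.2 hv
  rw [h3, mul_zero] at h2
  exact absurd h2 (not_le.2 (Real.sqrt_pos.2 h1))

variable [ConnectedSpace S]

/-- A local diffeomorphism has open image; here the image is also compact, hence all of the
noncompact connected space `ℝⁿ`. -/
theorem not_isSpacelike_of_compactSpace [CompactSpace S] (hn : 1 ≤ n) (N : NullFrame a) :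
    ¬ IsSpacelike a ψ := by
  intro h
  have hF := h.isLocalDiffeomorph_coord N
  have : Nonempty (Fin n) := ⟨⟨0, hn⟩⟩
  have hcpt : IsCompact (Set.range (N.coord ∘ ψ)) := isCompact_range hF.contMDiff.continuous
  have huniv : Set.range (N.coord ∘ ψ) = Set.univ :=
    IsClopen.eq_univ ⟨hcpt.isClosed, hF.isOpen_range⟩ (Set.range_nonempty _)
  rw [huniv] at hcpt
  exact noncompact_univ (EuclideanSpace ℝ (Fin n)) hcpt

variable [T2Space S]

theorem IsSpacelike.bijective_coord (h : IsSpacelike a ψ) (hc : IsCompleteHypersurface ψ)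
    (hb : IsBoundedAwayFromFuture a ψ) : Function.Bijective (N.coord ∘ ψ) := by
  obtain ⟨τ, hτ, hle⟩ := hb
  let : ∀ x : S, ENorm (TangentSpace (𝓡 n) x) := inducedENorm ψ
  have : ∀ x : S, ENormSMulClass ℝ (TangentSpace (𝓡 n) x) := inducedEnormSMulClass ψ
  refine bijective_of_expanding (K := ENNReal.ofReal τ) (h.isLocalDiffeomorph_coord N)
    ENNReal.ofReal_ne_top (fun p v => ?_) hc
  refine le_of_le_of_eq ?_ (congrArg (ENNReal.ofReal τ * ·)
    (ofReal_norm (E := EuclideanSpace ℝ (Fin n)) _))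
  rw [← ENNReal.ofReal_mul hτ.le]
  exact ENNReal.ofReal_le_ofReal ((h.inducedForm_le N p v).trans
    (mul_le_mul_of_nonneg_right (hle p) (norm_nonneg _)))

/-- The horospherical coordinate as a diffeomorphism of a complete hypersurface. -/
def IsSpacelike.coordDiffeomorph (h : IsSpacelike a ψ) (hc : IsCompleteHypersurface ψ)
    (hb : IsBoundedAwayFromFuture a ψ) : S ≃ₘ⟮𝓡 n, 𝓡 n⟯ EuclideanSpace ℝ (Fin n) :=
  { Equiv.ofBijective _ (h.bijective_coord N hc hb) with
    contMDiff_toFun := h.contMDiff_coord N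
    contMDiff_invFun := contMDiff_of_rightInverse (h.isLocalDiffeomorph_coord N)
      (h.bijective_coord N hc hb).injective
      (Equiv.ofBijective _ (h.bijective_coord N hc hb)).apply_symm_apply }

theorem IsSpacelike.coe_coordDiffeomorph (h : IsSpacelike a ψ) (hc : IsCompleteHypersurface ψ)
    (hb : IsBoundedAwayFromFuture a ψ) : ⇑(h.coordDiffeomorph N hc hb) = N.coord ∘ ψ := rfl

theorem IsSpacelike.isDiffeomorphismOnto_leafProj (N : NullFrame a) (h : IsSpacelike a ψ)
    (hc : IsCompleteHypersurface ψ) (hb : IsBoundedAwayFromFuture a ψ) :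
    IsDiffeomorphismOnto (leafProj a ∘ ψ) (leaf a 1) := by
  have hP : leafProj a ∘ ψ = N.param ∘ (N.coord ∘ ψ) :=
    funext fun p => (N.param_coord (h.mem p)).symm
  have hΦ := h.coe_coordDiffeomorph N hc hb
  rw [hP]
  -- `proj` inverts `param` and is linear on the whole ambient space, so the inverse extends
  -- smoothly to `Set.univ`.
  refine ⟨N.contDiff_param.contMDiff.comp (h.contMDiff_coord N), ?_, Set.univ,
    (h.coordDiffeomorph N hc hb).symm ∘ N.proj, isOpen_univ, Set.subset_univ _, ?_, fun p => ?_⟩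
  · rw [Set.range_comp, (h.bijective_coord N hc hb).surjective.range_eq, Set.image_univ]
    ext q
    exact ⟨by rintro ⟨w, rfl⟩; exact N.param_mem_leaf w, fun hq => ⟨_, N.param_proj hq⟩⟩
  · exact ((h.coordDiffeomorph N hc hb).symm.contMDiff.comp
      N.proj.contDiff.contMDiff).contMDiffOn
  · rw [← hΦ]
    simp [N.proj_param]

end Hypersurface
end SteadyState
end


theorem mainTheorem4 (n : ℕ) (a : SteadyState.Mink n) (ha : SteadyState.IsPastNull a) :
    (∀ (S : Type*) [TopologicalSpace S] [T2Space S] [ConnectedSpace S]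
        [ChartedSpace (EuclideanSpace ℝ (Fin n)) S] [IsManifold (𝓡 n) ∞ S]
        (ψ : S → SteadyState.Mink n),
        SteadyState.IsSpacelike a ψ → SteadyState.IsCompleteHypersurface ψ →
        SteadyState.IsBoundedAwayFromFuture a ψ →
        Nonempty (S ≃ₘ⟮𝓡 n, 𝓡 n⟯ EuclideanSpace ℝ (Fin n)) ∧
        ∃ P : S → SteadyState.Mink n,
          (∀ p q, SteadyState.IsGeodesicProjection a (ψ p) q ↔ q = P p) ∧
          SteadyState.IsDiffeomorphismOnto P (SteadyState.leaf a 1)) ∧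
    (1 ≤ n → ∀ (S : Type*) [TopologicalSpace S] [T2Space S] [ConnectedSpace S]
        [ChartedSpace (EuclideanSpace ℝ (Fin n)) S] [IsManifold (𝓡 n) ∞ S] [CompactSpace S]
        (ψ : S → SteadyState.Mink n), ¬ SteadyState.IsSpacelike a ψ) := by

  obtain ⟨N⟩ := SteadyState.exists_nullFrame ha
  refine ⟨?_, ?_⟩
  · intro S _ _ _ _ _ ψ h hc hb
    exact ⟨⟨h.coordDiffeomorph N hc hb⟩, _,
      fun p q => SteadyState.isGeodesicProjection_iff ha (h.mem p),
      h.isDiffeomorphismOnto_leafProj N hc hb⟩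
  · intro hn S _ _ _ _ _ _ ψ
    exact SteadyState.not_isSpacelike_of_compactSpace hn N
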